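/- **Setting.** Alice and Bob share an untrusted state, a unit vector $|\psi\rangle\in\mathcal H_A\otimes\mathcal H_B$, where $\mathcal H_A,\mathcal H_B$ are arbitrary complex Hilbert spaces (we write $S$ for the shared system). Alice's device has self-adjoint observables with square $1$, denoted $X_A,Y_A,Z_A,D_A,E^+_A,E^-_A,F_A$, on $\mathcal H_A$. Bob's device has such observables $X_B,Y_B,Z_B$ on $\mathcal H_B$. Nothing else is assumed about them. The corresponding ideal observables on a qubit are, for Alice, the Pauli matrices $X,Y,Z$ and $D=\frac{X+Z}{\sqrt2}$, $E^\pm=\frac{\pm X+Y}{\sqrt2}$, $F=\frac{Y+Z}{\sqrt2}$. For Bob they are given by the same expressions with $Y$ replaced by $-Y$. For a label $\sigma$ write $\sigma_{Q_A},\sigma_{Q_B}$ for the ideal observables of Alice and Bob. Let $|\phi^+\rangle=\frac1{\sqrt2}(|00\rangle+|11\rangle)$ on qubits $Q_A,Q_B$, and for an observable $T$ let $\Pi^{\pm}_T=\frac12(I\pm T)$. Put $M_B=iZ_BX_BY_B$, which is unitary and satisfies $Y_B=(-iX_BZ_B)M_B$. Let $V:\mathcal H_B\to\mathcal H_B\otimes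 Q_B\otimes R_B$ (with $Q_B$, $R_B$ qubits) be the reduced swap followed by the phase kickback, $$V|b\rangle=\sum_{k,l\in\{0,1\}}\tfrac12\bigl(I+(-1)^lM_B\bigr)\,X_B^k\,\tfrac12\bigl(I+(-1)^kZ_B\bigr)|b\rangle\otimes|k\rangle_{Q_B}|l\rangle_{R_B}.$$ For an outcome $\pm$ of Alice, put $a=0$ for $+$ and $a=1$ for $-$, and let $\bar\Phi=(|v\rangle\mapsto|v\rangle|a\rangle_{Q_A})\otimes V$. **Theorem.** There is a universal constant $C$ with the following property. Suppose that for each of the 14 pairs $\alpha\beta\in\{XX,XY,XZ,YY,YZ,ZZ,DX,DZ,E^+X,E^+Y,E^-X,E^-Y,FY,FZ\}$ the correlation is $\chi$-close to the ideal one, $$\bigl|\langle\psi|\alpha_A\otimes\beta_B|\psi\rangle-\langle\phi^+|\alpha_{Q_A}\otimes\beta_{Q_B}|\phi^+\rangle\bigr|\le\chi .$$ Then $V$ is an isometry, so that $\bar\Phi$ is a local isometry. Moreover, for every measurement $\sigma\in\{X,Y,Z,D,E^+,E^-,F\}$ of Alice and each outcome $\pm$ there is a unit vector $|junk_\sigma\rangle\in\mathcal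 H_A\otimes\mathcal H_B$ (it may depend on $\sigma$ and on the outcome) with $$\Bigl\|\bar\Phi\bigl(\sqrt2\,\Pi^{\pm}_{\sigma_A}|\psi\rangle\bigr)-\frac{1}{2\sqrt{p_\sigma}}\Bigl[(I+M_B)|junk_\sigma\rangle_S\,\Pi^{\pm}_{Z_{Q_A}}\Pi^{\pm}_{\sigma_{Q_B}}|\phi^+\rangle_Q|0\rangle_{R_B}+(I-M_B)|junk_\sigma\rangle_S\,\Pi^{\pm}_{Z_{Q_A}}\bigl(\Pi^{\pm}_{\sigma_{Q_B}}\bigr)^{*}|\phi^+\rangle_Q|1\rangle_{R_B}\Bigr]\Bigr\|_2\le\tilde\epsilon,\qquad\tilde\epsilon=C\chi^{1/4},$$ where $p_\sigma=\langle\phi^+|\Pi^{\pm}_{Z_{Q_A}}\Pi^{\pm}_{\sigma_{Q_A}}|\phi^+\rangle$ (so that the two-qubit vectors divided by $\sqrt{p_\sigma}$ are unit vectors) and $*$ denotes entrywise complex conjugation. In words, Bob's register $Q_B$ holds the ideal remotely prepared qubit up to complex conjugation, and $R_B$ flags the conjugation. -/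

import Mathlib

open scoped TensorProduct Kronecker ComplexConjugate

universe u v

noncomputable section

namespace RemotePrep

/-- The measurement settings of Alice's device; `Ep`, `Em` stand for `E⁺`, `E⁻`. -/
inductive AliceSetting
  | X | Y | Z | D | Ep | Em | F

/-- The measurement settings of Bob's device. -/
inductive BobSetting
  | X | Y | Z

/-- The 14 pairs of settings whose correlations are tested in the protocol. -/
def testedSettings : Set (AliceSetting × BobSetting) :=
  {(.X, .X), (.X, .Y), (.X, .Z), (.Y, .Y), (.Y, .Z), (.Z, .Z),
   (.D, .X), (.D, .Z), (.Ep, .X), (.Ep, .Y), (.Em, .X), (.Em, .Y), (.F, .Y), (.F, .Z)}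

/-! ### The reference experiment -/

def pauliX : Matrix (Fin 2) (Fin 2) ℂ := !![0, 1; 1, 0]
def pauliY : Matrix (Fin 2) (Fin 2) ℂ := !![0, -Complex.I; Complex.I, 0]
def pauliZ : Matrix (Fin 2) (Fin 2) ℂ := !![1, 0; 0, -1]

/-- The observable with label `σ` built from three given Pauli-like matrices:
`D = (X + Z)/√2`, `E^± = (±X + Y)/√2`, `F = (Y + Z)/√2`. -/
def combine (X Y Z : Matrix (Fin 2) (Fin 2) ℂ) : AliceSetting → Matrix (Fin 2) (Fin 2) ℂ
  | .X => X
  | .Y => Y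
  | .Z => Z
  | .D => ((1 / √2 : ℝ) : ℂ) • (X + Z)
  | .Ep => ((1 / √2 : ℝ) : ℂ) • (X + Y)
  | .Em => ((1 / √2 : ℝ) : ℂ) • (-X + Y)
  | .F => ((1 / √2 : ℝ) : ℂ) • (Y + Z)

/-- The ideal observable `σ_{Q_A}` on Alice's qubit (`Y_A = Y`). -/
def idealA : AliceSetting → Matrix (Fin 2) (Fin 2) ℂ :=
  combine pauliX pauliY pauliZ

/-- The ideal observable `σ_{Q_B}` with the same label on Bob's qubit (`Y_B = -Y`). -/
def idealB : AliceSetting → Matrix (Fin 2) (Fin 2) ℂ :=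
  combine pauliX (-pauliY) pauliZ

/-- A setting of Bob, seen as the label of an observable. -/
def BobSetting.label : BobSetting → AliceSetting
  | .X => .X
  | .Y => .Y
  | .Z => .Z

/-- The Bell state `(|00⟩ + |11⟩)/√2`. -/
def phiPlus : Fin 2 × Fin 2 → ℂ :=
  fun q => if q.1 = q.2 then ((1 / √2 : ℝ) : ℂ) else 0

/-- The expectation value `⟨φ⁺| T |φ⁺⟩`. -/
def bellExpect (T : Matrix (Fin 2 × Fin 2) (Fin 2 × Fin 2) ℂ) : ℂ :=
  star phiPlus ⬝ᵥ (T.mulVec phiPlus)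

/-- The ideal correlation `⟨φ⁺| α ⊗ β |φ⁺⟩`. -/
def idealCorrelation (α : AliceSetting) (β : BobSetting) : ℂ :=
  bellExpect (idealA α ⊗ₖ idealB β.label)

/-- The projector `(1 + (-1)^a T)/2` for outcome `a`, where `a = 0` is the outcome `+1` and
`a = 1` the outcome `-1`. -/
def matProj (a : Fin 2) (T : Matrix (Fin 2) (Fin 2) ℂ) : Matrix (Fin 2) (Fin 2) ℂ :=
  (1 / 2 : ℂ) • (1 + (-1 : ℂ) ^ (a : ℕ) • T)

/-- `p_σ = ⟨φ⁺| Π^±_{Z_{Q_A}} Π^±_{σ_{Q_A}} |φ⁺⟩`, which is also the squared norm of both vectors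
`refQubits a σ l` below. -/
def refWeight (a : Fin 2) (σ : AliceSetting) : ℝ :=
  (bellExpect ((matProj a (idealA .Z) * matProj a (idealA σ)) ⊗ₖ
    (1 : Matrix (Fin 2) (Fin 2) ℂ))).re

/-- For `l = 0` the vector `Π^±_{Z_{Q_A}} Π^±_{σ_{Q_B}} |φ⁺⟩`, for `l = 1` the vector
`Π^±_{Z_{Q_A}} (Π^±_{σ_{Q_B}})^* |φ⁺⟩`, with `*` the entrywise complex conjugate. -/
def refQubits (a : Fin 2) (σ : AliceSetting) (l : Fin 2) : Fin 2 × Fin 2 → ℂ :=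
  (matProj a (idealA .Z) ⊗ₖ
    (if l = 0 then matProj a (idealB σ) else (matProj a (idealB σ)).map conj)).mulVec phiPlus

/-! ### The physical experiment -/

variable {HA : Type u} [NormedAddCommGroup HA] [InnerProductSpace ℂ HA]
variable {HB : Type v} [NormedAddCommGroup HB] [InnerProductSpace ℂ HB]

/-- The Hilbert space tensor product `S = S_A ⊗ S_B`. -/
abbrev Shared (HA : Type u) [NormedAddCommGroup HA] [InnerProductSpace ℂ HA]
    (HB : Type v) [NormedAddCommGroup HB] [InnerProductSpace ℂ HB] : Type (max u v) :=
  UniformSpace.Completion (HA ⊗[ℂ] HB)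

/-- The operator `A ⊗ B` on the Hilbert space tensor product. -/
def tensorOp (A : HA →L[ℂ] HA) (B : HB →L[ℂ] HB) : Shared HA HB →L[ℂ] Shared HA HB :=
  (TensorProduct.mapL A B).completion

/-- A `±1`-valued observable of a projective measurement. -/
def IsBinaryObservable {H : Type*} [NormedAddCommGroup H] [InnerProductSpace ℂ H]
    [CompleteSpace H] (T : H →L[ℂ] H) : Prop :=
  IsSelfAdjoint T ∧ T * T = 1

/-- The tested correlations `⟨ψ| α ⊗ β |ψ⟩` are all `χ`-close to the ideal ones. -/
def CorrelationsClose (A : AliceSetting → HA →L[ℂ] HA) (B : BobSetting → HB →L[ℂ] HB)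
    (ψ : Shared HA HB) (χ : ℝ) : Prop :=
  ∀ q ∈ testedSettings,
    ‖inner ℂ ψ (tensorOp (A q.1) (B q.2) ψ) - idealCorrelation q.1 q.2‖ ≤ χ

/-- The projector `(1 + (-1)^a T)/2` for outcome `a`. -/
def opProj {H : Type*} [NormedAddCommGroup H] [InnerProductSpace ℂ H]
    (a : Fin 2) (T : H →L[ℂ] H) : H →L[ℂ] H :=
  (1 / 2 : ℂ) • (1 + (-1 : ℂ) ^ (a : ℕ) • T)

/-- The unitary `M_{S_B} = i Z_B X_B Y_B`, that is, the one with
`Y_B = (-i X_B Z_B) M_{S_B}`, where `-i X Z = -Y` on a qubit. -/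
def phaseOp (B : BobSetting → HB →L[ℂ] HB) : HB →L[ℂ] HB :=
  Complex.I • (B .Z * B .X * B .Y)

/-- The component of the reduced swap gate at `|k⟩` of the register `Q_B`. -/
def swapPart (B : BobSetting → HB →L[ℂ] HB) (k : Fin 2) : HB →L[ℂ] HB :=
  B .X ^ (k : ℕ) * opProj k (B .Z)

/-- The component of the phase kickback at `|l⟩` of the register `R_B`. -/
def kickPart (B : BobSetting → HB →L[ℂ] HB) (l : Fin 2) : HB →L[ℂ] HB :=
  opProj l (phaseOp B)

/-- `H ⊗ ℂ^ι` as the `ℓ²`-direct sum of copies of `H`, for a register with basis kets `|i⟩`. -/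
abbrev WithRegister (ι : Type) [Fintype ι] (H : Type*) : Type _ :=
  PiLp 2 (fun _ : ι => H)

/-- The local map `(v ↦ v ⊗ |a⟩_{Q_A}) ⊗ V` from `S` to `S ⊗ Q_A ⊗ Q_B ⊗ R_B`, for an isometry `V`
from `S_B` to `S_B ⊗ Q_B ⊗ R_B`. -/
def localIsometry (a : Fin 2) (V : HB →ₗᵢ[ℂ] WithRegister (Fin 2 × Fin 2) HB)
    (Ψ : Shared HA HB) : WithRegister (Fin 2 × Fin 2 × Fin 2) (Shared HA HB) :=
  WithLp.toLp 2 fun q =>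
    if q.1 = a then
      tensorOp (1 : HA →L[ℂ] HA) (PiLp.proj 2 (fun _ : Fin 2 × Fin 2 => HB) q.2 ∘L
        V.toContinuousLinearMap) Ψ
    else 0

/-- The ideal state
`1/(2 √p_σ) ∑_l (1 + (-1)^l M_{S_B}) |junk⟩_S ⊗ refQubits a σ l ⊗ |l⟩_{R_B}`. -/
def targetState (B : BobSetting → HB →L[ℂ] HB) (a : Fin 2) (σ : AliceSetting)
    (junk : Shared HA HB) : WithRegister (Fin 2 × Fin 2 × Fin 2) (Shared HA HB) :=
  WithLp.toLp 2 fun q =>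
    (((1 / √(refWeight a σ) : ℝ) : ℂ) * refQubits a σ q.2.2 (q.1, q.2.1)) •
      tensorOp (1 : HA →L[ℂ] HA) (opProj q.2.2 (phaseOp B)) junk

end RemotePrep

end

open RemotePrep

noncomputable section

namespace RemotePrep

/-
The 14 correlations determine the Gram matrix of the vectors `B_β ψ` and their overlaps with the
vectors `A_σ ψ`, so each `A_σ ψ` is close to the combination of the `B_β ψ` that holds in the ideal
case (steering). The observables `D`, `E⁺`, `F` of Alice, which square to `1`, then force Bob's
observables to anticommute pairwise on `ψ`. Hence on `V ψ` Bob's observables act as the Pauli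
matrices of the register `Q_B`, complex conjugated where `R_B` holds `1`, and by steering Alice's
projector `Π^a_σ` acts on `V ψ` as a rank-one 2×2 matrix. So the components of `V Π^a_σ ψ` are all
proportional to the one with `Q_B` in the state `a`, and this component, normalised, is the junk
state. Its norm is under control because `V` and the map from junk states to prepared states are
isometries, while `⟨ψ, A_σ ψ⟩` is close to `0`.
-/

section Tensor

variable {HA : Type u} [NormedAddCommGroup HA] [InnerProductSpace ℂ HA]
variable {HB : Type v} [NormedAddCommGroup HB] [InnerProductSpace ℂ HB]

lemma tensorOp_coe (S : HA →L[ℂ] HA) (T : HB →L[ℂ] HB) (x : HA ⊗[ℂ] HB) :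
    tensorOp S T (x : Shared HA HB) = ((TensorProduct.mapL S T x : HA ⊗[ℂ] HB) : Shared HA HB) :=
  ContinuousLinearMap.completion_apply_coe _ _

lemma sharedOp_ext {f g : Shared HA HB →L[ℂ] Shared HA HB}
    (h : ∀ x : HA ⊗[ℂ] HB, f (x : Shared HA HB) = g (x : Shared HA HB)) : f = g := by
  ext v
  induction v using UniformSpace.Completion.induction_on with
  | hp => exact isClosed_eq f.continuous g.continuous
  | ih x => exact h x

lemma tensorOp_mul (S S' : HA →L[ℂ] HA) (T T' : HB →L[ℂ] HB) :
    tensorOp (S * S') (T * T') = tensorOp S T * tensorOp S' T' :=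
  sharedOp_ext fun x => by
    simp only [tensorOp_coe, TensorProduct.mapL_mul, mul_apply_eq_comp]

lemma tensorOp_one_one : tensorOp (1 : HA →L[ℂ] HA) (1 : HB →L[ℂ] HB) = 1 :=
  sharedOp_ext fun x => by
    rw [tensorOp_coe]
    exact congrArg _ (DFunLike.congr_fun (TensorProduct.mapL_id_id (𝕜 := ℂ) (E := HA) (G := HB)) x)

/-- The action `S ↦ S ⊗ 1` of Alice's operators on the shared system. -/
def leftAction : (HA →L[ℂ] HA) →ₐ[ℂ] (Shared HA HB →L[ℂ] Shared HA HB) :=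
  AlgHom.ofLinearMap
    { toFun S := tensorOp S 1
      map_add' S S' := sharedOp_ext fun x => by
        simp only [tensorOp_coe, TensorProduct.mapL_add_left, _root_.add_apply,
          UniformSpace.Completion.coe_add]
      map_smul' c S := sharedOp_ext fun x => by
        simp only [tensorOp_coe, TensorProduct.mapL_smul_left, _root_.smul_apply,
          UniformSpace.Completion.coe_smul, RingHom.id_apply] }
    tensorOp_one_one
    fun S S' => by
      change tensorOp (S * S') 1 = tensorOp S 1 * tensorOp S' 1
      rw [← tensorOp_mul, mul_one]

/-- The action `T ↦ 1 ⊗ T` of Bob's operators on the shared system. -/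
def rightAction : (HB →L[ℂ] HB) →ₐ[ℂ] (Shared HA HB →L[ℂ] Shared HA HB) :=
  AlgHom.ofLinearMap
    { toFun T := tensorOp 1 T
      map_add' T T' := sharedOp_ext fun x => by
        simp only [tensorOp_coe, TensorProduct.mapL_add_right, _root_.add_apply,
          UniformSpace.Completion.coe_add]
      map_smul' c T := sharedOp_ext fun x => by
        simp only [tensorOp_coe, TensorProduct.mapL_smul_right, _root_.smul_apply,
          UniformSpace.Completion.coe_smul, RingHom.id_apply] }
    tensorOp_one_one
    fun T T' => by
      change tensorOp 1 (T * T') = tensorOp 1 T * tensorOp 1 T'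
      rw [← tensorOp_mul, mul_one]

lemma leftAction_apply (S : HA →L[ℂ] HA) :
    leftAction S = tensorOp S (1 : HB →L[ℂ] HB) := rfl

lemma rightAction_apply (T : HB →L[ℂ] HB) :
    rightAction T = tensorOp (1 : HA →L[ℂ] HA) T := rfl

lemma leftAction_mul_rightAction (S : HA →L[ℂ] HA) (T : HB →L[ℂ] HB) :
    leftAction S * rightAction T = tensorOp S T := by
  rw [leftAction_apply, rightAction_apply, ← tensorOp_mul, mul_one, one_mul]

lemma commute_leftAction_rightAction (S : HA →L[ℂ] HA) (T : HB →L[ℂ] HB) :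
    Commute (leftAction S) (rightAction T) := by
  rw [Commute, SemiconjBy, leftAction_mul_rightAction, leftAction_apply, rightAction_apply,
    ← tensorOp_mul, mul_one, one_mul]

lemma inner_mapL_left {S : HA →L[ℂ] HA} {T : HB →L[ℂ] HB}
    (hS : ∀ u v, inner ℂ (S u) v = inner ℂ u (S v)) (hT : ∀ u v, inner ℂ (T u) v = inner ℂ u (T v))
    (x y : HA ⊗[ℂ] HB) :
    inner ℂ (TensorProduct.mapL S T x) y = inner ℂ x (TensorProduct.mapL S T y) := by
  induction x using TensorProduct.induction_on with
  | zero => simp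
  | add x x' hx hx' => simp only [map_add, inner_add_left, hx, hx']
  | tmul a b =>
    induction y using TensorProduct.induction_on with
    | zero => simp
    | add y y' hy hy' => simp only [map_add, inner_add_right, hy, hy']
    | tmul c d => simp only [TensorProduct.mapL_tmul, TensorProduct.inner_tmul, hS, hT]

lemma inner_tensorOp_left {S : HA →L[ℂ] HA} {T : HB →L[ℂ] HB}
    (hS : ∀ u v, inner ℂ (S u) v = inner ℂ u (S v)) (hT : ∀ u v, inner ℂ (T u) v = inner ℂ u (T v))
    (u v : Shared HA HB) : inner ℂ (tensorOp S T u) v = inner ℂ u (tensorOp S T v) := by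
  induction u, v using UniformSpace.Completion.induction_on₂ with
  | hp =>
    exact isClosed_eq (((tensorOp S T).continuous.comp continuous_fst).inner continuous_snd)
      (continuous_fst.inner ((tensorOp S T).continuous.comp continuous_snd))
  | ih x y =>
    simp only [tensorOp_coe, UniformSpace.Completion.inner_coe]
    exact inner_mapL_left hS hT x y

end Tensor

section AlgebraHom

variable {H K : Type*} [NormedAddCommGroup H] [InnerProductSpace ℂ H]
  [NormedAddCommGroup K] [InnerProductSpace ℂ K] (f : (H →L[ℂ] H) →ₐ[ℂ] (K →L[ℂ] K))

lemma map_opProj (a : Fin 2) (T : H →L[ℂ] H) : f (opProj a T) = opProj a (f T) := by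
  simp only [opProj, map_smul, map_add, map_one]

lemma map_kickPart (B : BobSetting → H →L[ℂ] H) (l : Fin 2) :
    f (kickPart B l) = kickPart (fun β => f (B β)) l := by
  simp only [kickPart, phaseOp, map_opProj, map_smul, map_mul]

lemma map_swapPart (B : BobSetting → H →L[ℂ] H) (k : Fin 2) :
    f (swapPart B k) = swapPart (fun β => f (B β)) k := by
  simp only [swapPart, map_opProj, map_mul, map_pow]

end AlgebraHom

section Reflection

variable {H : Type*} [NormedAddCommGroup H] [InnerProductSpace ℂ H]

/-- A symmetric involution: a `±1`-valued observable on a space that need not be complete. -/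
structure IsReflection (T : H →L[ℂ] H) : Prop where
  inner_left : ∀ u v, inner ℂ (T u) v = inner ℂ u (T v)
  mul_self : T * T = 1

namespace IsReflection

variable {T : H →L[ℂ] H}

lemma apply_apply (hT : IsReflection T) (v : H) : T (T v) = v :=
  DFunLike.congr_fun hT.mul_self v

lemma inner_apply_apply (hT : IsReflection T) (u v : H) : inner ℂ (T u) (T v) = inner ℂ u v := by
  rw [hT.inner_left, hT.apply_apply]

lemma norm_apply (hT : IsReflection T) (v : H) : ‖T v‖ = ‖v‖ := by
  rw [@norm_eq_sqrt_re_inner ℂ, hT.inner_apply_apply, ← @norm_eq_sqrt_re_inner ℂ]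

lemma norm_le_one (hT : IsReflection T) : ‖T‖ ≤ 1 :=
  T.opNorm_le_bound zero_le_one fun v => by rw [hT.norm_apply, one_mul]

end IsReflection

lemma IsBinaryObservable.isReflection [CompleteSpace H] {T : H →L[ℂ] H}
    (h : IsBinaryObservable T) : IsReflection T :=
  ⟨h.1.isSymmetric, h.2⟩

lemma IsReflection.leftAction {HA : Type u} [NormedAddCommGroup HA] [InnerProductSpace ℂ HA]
    {HB : Type v} [NormedAddCommGroup HB] [InnerProductSpace ℂ HB] {S : HA →L[ℂ] HA}
    (hS : IsReflection S) : IsReflection (leftAction S : Shared HA HB →L[ℂ] Shared HA HB) :=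
  ⟨inner_tensorOp_left hS.inner_left fun _ _ => rfl, by rw [← map_mul, hS.mul_self, map_one]⟩

lemma IsReflection.rightAction {HA : Type u} [NormedAddCommGroup HA] [InnerProductSpace ℂ HA]
    {HB : Type v} [NormedAddCommGroup HB] [InnerProductSpace ℂ HB] {T : HB →L[ℂ] HB}
    (hT : IsReflection T) : IsReflection (rightAction T : Shared HA HB →L[ℂ] Shared HA HB) :=
  ⟨inner_tensorOp_left (fun _ _ => rfl) hT.inner_left, by rw [← map_mul, hT.mul_self, map_one]⟩

lemma opProj_apply (a : Fin 2) (T : H →L[ℂ] H) (v : H) :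
    opProj a T v = (1 / 2 : ℂ) • (v + (-1 : ℂ) ^ (a : ℕ) • T v) := rfl

lemma sum_norm_sq_opProj {T : H →L[ℂ] H} (hT : ∀ v, ‖T v‖ = ‖v‖) (v : H) :
    ∑ a, ‖opProj a T v‖ ^ 2 = ‖v‖ ^ 2 := by
  have h := parallelogram_law_with_norm ℂ v (T v)
  rw [hT] at h
  simp only [Fin.sum_univ_two, opProj_apply, norm_smul, mul_pow, Fin.val_zero, Fin.val_one,
    pow_zero, pow_one, one_smul, neg_smul, ← sub_eq_add_neg]
  norm_num
  linarith

lemma norm_opProj_le {T : H →L[ℂ] H} (hT : ∀ v, ‖T v‖ = ‖v‖) (a : Fin 2) (v : H) :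
    ‖opProj a T v‖ ≤ ‖v‖ := by
  rw [← pow_le_pow_iff_left₀ (norm_nonneg _) (norm_nonneg _) two_ne_zero,
    ← sum_norm_sq_opProj hT v]
  exact Finset.single_le_sum (f := fun a => ‖opProj a T v‖ ^ 2) (fun _ _ => sq_nonneg _)
    (Finset.mem_univ a)

end Reflection

section Isometry

variable {H : Type*} [NormedAddCommGroup H] [InnerProductSpace ℂ H]
variable {B : BobSetting → H →L[ℂ] H}

lemma norm_phaseOp_apply (hB : ∀ β, IsReflection (B β)) (v : H) : ‖phaseOp B v‖ = ‖v‖ := by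
  simp only [phaseOp, _root_.smul_apply, mul_apply_eq_comp, norm_smul, Complex.norm_I,
    (hB _).norm_apply, one_mul]

lemma norm_swapPart_apply (hB : ∀ β, IsReflection (B β)) (k : Fin 2) (v : H) :
    ‖swapPart B k v‖ = ‖opProj k (B .Z) v‖ := by
  obtain rfl | rfl : k = 0 ∨ k = 1 := by omega
  · simp only [swapPart, Fin.val_zero, pow_zero, one_mul]
  · simp only [swapPart, Fin.val_one, pow_one, mul_apply_eq_comp, (hB _).norm_apply]

lemma norm_kickPart_le (hB : ∀ β, IsReflection (B β)) (l : Fin 2) (v : H) :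
    ‖kickPart B l v‖ ≤ ‖v‖ :=
  norm_opProj_le (norm_phaseOp_apply hB) l v

lemma norm_swapPart_le (hB : ∀ β, IsReflection (B β)) (k : Fin 2) (v : H) :
    ‖swapPart B k v‖ ≤ ‖v‖ :=
  (norm_swapPart_apply hB k v).trans_le (norm_opProj_le (hB _).norm_apply k v)

/-- Bob's isometry `V`: the reduced swap gate followed by the phase kickback. -/
def swapKick (B : BobSetting → H →L[ℂ] H) (hB : ∀ β, IsReflection (B β)) :
    H →ₗᵢ[ℂ] WithRegister (Fin 2 × Fin 2) H where
  toFun v := WithLp.toLp 2 fun q => kickPart B q.2 (swapPart B q.1 v)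
  map_add' u v := by ext; simp only [map_add, PiLp.add_apply]
  map_smul' c v := by ext; simp only [map_smul, PiLp.smul_apply, RingHom.id_apply]
  norm_map' v := by
    rw [← sq_eq_sq₀ (norm_nonneg _) (norm_nonneg _), PiLp.norm_sq_eq_of_L2]
    simp only [LinearMap.coe_mk, AddHom.coe_mk, Fintype.sum_prod_type, kickPart,
      sum_norm_sq_opProj (norm_phaseOp_apply hB), norm_swapPart_apply hB,
      sum_norm_sq_opProj (hB .Z).norm_apply]

lemma swapKick_apply (hB : ∀ β, IsReflection (B β)) (v : H) (k l : Fin 2) :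
    swapKick B hB v (k, l) = kickPart B l (swapPart B k v) := rfl

/-- The isometry that appends the qubit states `c l`, for the two values `l` of the flag, to the
two components of the phase kickback. -/
def appendQubit (B : BobSetting → H →L[ℂ] H) (hB : ∀ β, IsReflection (B β))
    (c : Fin 2 → Fin 2 → ℂ) (hc : ∀ l, ∑ k, ‖c l k‖ ^ 2 = 1) :
    H →ₗᵢ[ℂ] WithRegister (Fin 2 × Fin 2) H where
  toFun v := WithLp.toLp 2 fun q => c q.2 q.1 • kickPart B q.2 v
  map_add' u v := by ext; simp only [map_add, smul_add, PiLp.add_apply]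
  map_smul' a v := by ext; simp only [map_smul, smul_comm a, PiLp.smul_apply, RingHom.id_apply]
  norm_map' v := by
    rw [← sq_eq_sq₀ (norm_nonneg _) (norm_nonneg _), PiLp.norm_sq_eq_of_L2]
    simp only [LinearMap.coe_mk, AddHom.coe_mk, Fintype.sum_prod_type_right, norm_smul, mul_pow,
      ← Finset.sum_mul, hc, one_mul, kickPart, sum_norm_sq_opProj (norm_phaseOp_apply hB)]

lemma appendQubit_apply (hB : ∀ β, IsReflection (B β)) {c : Fin 2 → Fin 2 → ℂ}
    (hc : ∀ l, ∑ k, ‖c l k‖ ^ 2 = 1) (v : H) (k l : Fin 2) :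
    appendQubit B hB c hc v (k, l) = c l k • kickPart B l v := rfl

end Isometry

section Reference

instance : DecidableEq BobSetting
  | .X, .X | .Y, .Y | .Z, .Z => isTrue rfl
  | .X, .Y | .X, .Z | .Y, .X | .Y, .Z | .Z, .X | .Z, .Y => isFalse nofun

instance : Fintype BobSetting := ⟨{.X, .Y, .Z}, by rintro (_ | _ | _) <;> decide⟩

instance : Nontrivial BobSetting := ⟨.X, .Y, nofun⟩

lemma sum_bobSetting {M : Type*} [AddCommMonoid M] (f : BobSetting → M) :
    ∑ β, f β = f .X + (f .Y + f .Z) := by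
  change ∑ β ∈ {.X, .Y, .Z}, f β = _
  rw [Finset.sum_insert (by decide), Finset.sum_pair (by decide)]

/-- The coordinates of an ideal observable with respect to the three Pauli observables. -/
def bloch : AliceSetting → BobSetting → ℝ
  | .X, .X | .Y, .Y | .Z, .Z => 1
  | .D, .X | .D, .Z | .Ep, .X | .Ep, .Y | .Em, .Y | .F, .Y | .F, .Z => 1 / √2
  | .Em, .X => -(1 / √2)
  | _, _ => 0

lemma bloch_label (β γ : BobSetting) : bloch β.label γ = if β = γ then 1 else 0 := by
  cases β <;> cases γ <;> rfl

lemma inv_sqrt_two_sq : (1 / √2) ^ 2 = (1 / 2 : ℝ) := by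
  rw [div_pow, one_pow, Real.sq_sqrt zero_le_two]

lemma sum_sq_bloch (σ : AliceSetting) : ∑ β, bloch σ β ^ 2 = 1 := by
  rw [sum_bobSetting]
  cases σ <;> simp only [bloch, neg_sq, inv_sqrt_two_sq] <;> norm_num

lemma abs_bloch_le_one (σ : AliceSetting) (β : BobSetting) : |bloch σ β| ≤ 1 := by
  rw [← sq_le_one_iff_abs_le_one, ← sum_sq_bloch σ]
  exact Finset.single_le_sum (f := fun β => bloch σ β ^ 2) (fun _ _ => sq_nonneg _)
    (Finset.mem_univ β)

lemma sum_abs_bloch_le (σ : AliceSetting) : ∑ β, |bloch σ β| ≤ 2 := by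
  have h := sq_sum_le_card_mul_sum_sq (s := Finset.univ) (f := fun β => |bloch σ β|)
  simp only [sq_abs, sum_sq_bloch] at h
  rw [show (Finset.univ : Finset BobSetting).card = 3 from rfl] at h
  push_cast at h
  nlinarith

lemma bloch_Z_nonneg (σ : AliceSetting) : 0 ≤ bloch σ .Z := by
  cases σ <;> simp [bloch]

lemma mem_testedSettings_of_bloch_ne_zero {σ : AliceSetting} {β : BobSetting}
    (h : bloch σ β ≠ 0) : (σ, β) ∈ testedSettings := by
  cases σ <;> cases β <;> first | exact absurd rfl h | simp [testedSettings]

lemma label_mem_testedSettings (β γ : BobSetting) :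
    (β.label, γ) ∈ testedSettings ∨ (γ.label, β) ∈ testedSettings := by
  cases β <;> cases γ <;> simp [testedSettings, BobSetting.label]

lemma exists_sum_bloch_smul_eq {E : Type*} [AddCommGroup E] [Module ℂ E] {β γ : BobSetting}
    (h : β ≠ γ) :
    ∃ σ, ∀ f : BobSetting → E,
      ∑ α, (bloch σ α : ℂ) • f α = ((1 / √2 : ℝ) : ℂ) • (f β + f γ) := by
  let σ : AliceSetting := match β, γ with
    | .X, .Y | .Y, .X => .Ep
    | .X, .Z | .Z, .X => .D
    | _, _ => .F
  refine ⟨σ, fun f => ?_⟩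
  rw [sum_bobSetting]
  cases β <;> cases γ <;>
    first
    | exact absurd rfl h
    | simp only [σ, bloch, Complex.ofReal_zero, zero_smul, zero_add, smul_add, add_comm]

lemma idealA_eq (σ : AliceSetting) :
    idealA σ = !![(bloch σ .Z : ℂ), bloch σ .X - bloch σ .Y * Complex.I;
      bloch σ .X + bloch σ .Y * Complex.I, -bloch σ .Z] := by
  ext i j
  cases σ <;> fin_cases i <;> fin_cases j <;>
    simp [idealA, combine, bloch, pauliX, pauliY, pauliZ, mul_add, sub_eq_add_neg]

lemma idealB_eq (σ : AliceSetting) :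
    idealB σ = !![(bloch σ .Z : ℂ), bloch σ .X + bloch σ .Y * Complex.I;
      bloch σ .X - bloch σ .Y * Complex.I, -bloch σ .Z] := by
  ext i j
  cases σ <;> fin_cases i <;> fin_cases j <;>
    simp [idealB, combine, bloch, pauliX, pauliY, pauliZ, mul_add, sub_eq_add_neg]

lemma bellExpect_kronecker (S T : Matrix (Fin 2) (Fin 2) ℂ) :
    bellExpect (S ⊗ₖ T) = (∑ i, ∑ j, S i j * T i j) / 2 := by
  have h : ((1 / √2 : ℝ) : ℂ) * ((1 / √2 : ℝ) : ℂ) = 1 / 2 := by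
    rw [← sq, ← Complex.ofReal_pow, inv_sqrt_two_sq]; norm_num
  simp only [bellExpect, Matrix.mulVec, dotProduct, Fintype.sum_prod_type, phiPlus,
    Matrix.kroneckerMap_apply, Fin.sum_univ_two, Pi.star_apply]
  simp only [if_true, if_false, RCLike.star_def, Complex.conj_ofReal, zero_ne_one, mul_zero,
    add_zero, one_ne_zero, zero_add, star_zero, zero_mul]
  linear_combination (S 0 0 * T 0 0 + S 0 1 * T 0 1 + S 1 0 * T 1 0 + S 1 1 * T 1 1) * h

lemma idealCorrelation_eq (σ : AliceSetting) (β : BobSetting) :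
    idealCorrelation σ β = bloch σ β := by
  rw [idealCorrelation, bellExpect_kronecker, idealA_eq, idealB_eq]
  cases β <;> simp only [Fin.sum_univ_two, bloch_label, Matrix.of_apply, Matrix.cons_val,
    reduceCtorEq, if_true, if_false, Complex.ofReal_one, Complex.ofReal_zero]
  · ring
  · linear_combination -(bloch σ .Y : ℂ) * Complex.I_sq
  · ring

/-- The matrix `M` if the flag `l` is `0`, and its entrywise conjugate if `l` is `1`. -/
def flagConj (l : Fin 2) (M : Matrix (Fin 2) (Fin 2) ℂ) : Matrix (Fin 2) (Fin 2) ℂ :=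
  if l = 0 then M else M.map conj

lemma flagConj_idealB (l : Fin 2) (σ : AliceSetting) :
    flagConj l (idealB σ) =
      !![(bloch σ .Z : ℂ), bloch σ .X + (-1) ^ (l : ℕ) * bloch σ .Y * Complex.I;
        bloch σ .X - (-1) ^ (l : ℕ) * bloch σ .Y * Complex.I, -bloch σ .Z] := by
  rw [idealB_eq]
  ext i j
  fin_cases l <;> fin_cases i <;> fin_cases j <;> simp [flagConj, sub_eq_add_neg]

lemma flagConj_idealB_apply_eq_sum (l : Fin 2) (σ : AliceSetting) (i j : Fin 2) :
    flagConj l (idealB σ) i j = ∑ β, (bloch σ β : ℂ) * flagConj l (idealB β.label) i j := by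
  rw [sum_bobSetting]
  simp only [flagConj_idealB, bloch_label]
  fin_cases i <;> fin_cases j <;> simp <;> ring

lemma flagConj_matProj (l a : Fin 2) (M : Matrix (Fin 2) (Fin 2) ℂ) :
    flagConj l (matProj a M) = matProj a (flagConj l M) := by
  have h2 : (starRingEnd ℂ) 2 = 2 := map_ofNat _ 2
  ext i j
  fin_cases l <;> simp [flagConj, matProj, Matrix.one_apply, apply_ite, h2, mul_add]

/-- The projector `Π^a_σ` of Bob's qubit for the flag `0`, and its conjugate for the flag `1`. -/
def flagProj (l a : Fin 2) (σ : AliceSetting) : Matrix (Fin 2) (Fin 2) ℂ :=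
  flagConj l (matProj a (idealB σ))

lemma flagProj_eq (l a : Fin 2) (σ : AliceSetting) :
    flagProj l a σ = matProj a (flagConj l (idealB σ)) :=
  flagConj_matProj l a _

lemma refWeight_eq (a : Fin 2) (σ : AliceSetting) : refWeight a σ = (1 + bloch σ .Z) / 4 := by
  rw [refWeight, bellExpect_kronecker, idealA_eq, idealA_eq]
  fin_cases a <;> simp [matProj, Fin.sum_univ_two, Matrix.mul_apply, bloch] <;> ring

lemma refWeight_ge (a : Fin 2) (σ : AliceSetting) : 1 / 4 ≤ refWeight a σ := by
  rw [refWeight_eq]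
  linarith [bloch_Z_nonneg σ]

lemma flagProj_apply_self (l a : Fin 2) (σ : AliceSetting) :
    flagProj l a σ a a = ((2 * refWeight a σ : ℝ) : ℂ) := by
  rw [flagProj_eq, flagConj_idealB, refWeight_eq]
  fin_cases a <;> simp [matProj] <;> ring

lemma sum_norm_sq_flagProj (l a : Fin 2) (σ : AliceSetting) :
    ∑ k, ‖flagProj l a σ k a‖ ^ 2 = 2 * refWeight a σ := by
  have h := sum_sq_bloch σ
  rw [sum_bobSetting] at h
  simp only [flagProj_eq, flagConj_idealB, refWeight_eq, ← Complex.normSq_eq_norm_sq]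
  fin_cases a <;> fin_cases l <;>
    simp [matProj, Complex.normSq_apply, Fin.sum_univ_two] <;> linarith

lemma norm_flagProj_le_one (l a : Fin 2) (σ : AliceSetting) (k : Fin 2) :
    ‖flagProj l a σ k a‖ ≤ 1 := by
  rw [← sq_le_one_iff₀ (norm_nonneg _)]
  have hk := Finset.single_le_sum (f := fun k => ‖flagProj l a σ k a‖ ^ 2)
    (fun _ _ => sq_nonneg _) (Finset.mem_univ k)
  have hZ := (abs_le.1 (abs_bloch_le_one σ .Z)).2
  rw [sum_norm_sq_flagProj, refWeight_eq] at hk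
  linarith

lemma det_flagProj (l a : Fin 2) (σ : AliceSetting) : (flagProj l a σ).det = 0 := by
  have h := sum_sq_bloch σ
  rw [sum_bobSetting] at h
  have h' := congrArg ((↑) : ℝ → ℂ) h
  push_cast at h'
  rw [flagProj_eq, flagConj_idealB, Matrix.det_fin_two]
  fin_cases a <;> fin_cases l <;> simp [matProj] <;>
    linear_combination (-1 / 4 : ℂ) * h' + (bloch σ .Y : ℂ) ^ 2 / 4 * Complex.I_sq

lemma refQubits_eq (a : Fin 2) (σ : AliceSetting) (l i k : Fin 2) :
    refQubits a σ l (i, k) = if i = a then ((1 / √2 : ℝ) : ℂ) * flagProj l a σ k a else 0 := by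
  have hZ : matProj a (idealA .Z) = Matrix.single a a 1 := by
    ext i j
    fin_cases a <;> fin_cases i <;> fin_cases j <;> norm_num [matProj, idealA_eq, bloch]
  change (matProj a (idealA .Z) ⊗ₖ flagProj l a σ).mulVec phiPlus (i, k) = _
  rcases eq_or_ne i a with rfl | hi <;>
    simp [Matrix.mulVec, dotProduct, Fintype.sum_prod_type, phiPlus, Matrix.single_apply,
      Matrix.kroneckerMap_apply, mul_comm, *, Ne.symm]

/-- The qubit state that `Q_B` holds in the ideal case if `R_B` holds `l`, a unit vector. -/
def preparedQubit (a : Fin 2) (σ : AliceSetting) (l k : Fin 2) : ℂ :=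
  ((1 / √(refWeight a σ) : ℝ) : ℂ) * refQubits a σ l (a, k)

lemma preparedQubit_eq (a : Fin 2) (σ : AliceSetting) (l k : Fin 2) :
    preparedQubit a σ l k =
      ((1 / √(refWeight a σ) : ℝ) : ℂ) * (((1 / √2 : ℝ) : ℂ) * flagProj l a σ k a) := by
  rw [preparedQubit, refQubits_eq, if_pos rfl]

lemma sum_norm_sq_preparedQubit (a : Fin 2) (σ : AliceSetting) (l : Fin 2) :
    ∑ k, ‖preparedQubit a σ l k‖ ^ 2 = 1 := by
  have hp : 0 < refWeight a σ := by linarith [refWeight_ge a σ]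
  simp only [preparedQubit_eq, norm_mul, mul_pow, Complex.norm_real, Real.norm_eq_abs, sq_abs,
    ← Finset.mul_sum, sum_norm_sq_flagProj, inv_sqrt_two_sq]
  rw [div_pow, Real.sq_sqrt hp.le]
  field_simp

lemma apply_self_mul_apply_of_det_eq_zero {R : Matrix (Fin 2) (Fin 2) ℂ} (hR : R.det = 0)
    (a k j : Fin 2) : R a a * R k j = R k a * R a j := by
  rw [Matrix.det_fin_two] at hR
  fin_cases a <;> fin_cases k <;> fin_cases j <;> grind

end Reference

section GramMatrix

variable {H : Type*} [NormedAddCommGroup H] [InnerProductSpace ℂ H]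
variable {ι : Type*} [Fintype ι] {t : H} {b : ι → H} {n : ι → ℝ} {κ ε : ℝ}

lemma re_inner_sum_smul_ge (hn : ∑ i, n i ^ 2 = 1)
    (h : ∀ i, n i ≠ 0 → |(inner ℂ t (b i)).re - n i| ≤ κ) :
    1 - κ * ∑ i, |n i| ≤ (inner ℂ t (∑ i, (n i : ℂ) • b i)).re := by
  have hterm : ∀ i, n i ^ 2 - κ * |n i| ≤ n i * (inner ℂ t (b i)).re := fun i => by
    by_cases hi : n i = 0
    · simp [hi]
    · have := mul_le_mul_of_nonneg_left (h i hi) (abs_nonneg (n i))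
      rw [← abs_mul] at this
      linarith [(abs_le.1 this).1]
  calc 1 - κ * ∑ i, |n i| = ∑ i, (n i ^ 2 - κ * |n i|) := by
        rw [Finset.sum_sub_distrib, hn, Finset.mul_sum]
    _ ≤ ∑ i, n i * (inner ℂ t (b i)).re := Finset.sum_le_sum fun i _ => hterm i
    _ = (inner ℂ t (∑ i, (n i : ℂ) • b i)).re := by
        simp only [inner_sum, inner_smul_right, Complex.re_sum, Complex.re_ofReal_mul]

lemma norm_sum_smul_sq_le [DecidableEq ι] (hn : ∑ i, n i ^ 2 = 1)
    (h : ∀ i j, |(inner ℂ (b i) (b j)).re - if i = j then 1 else 0| ≤ ε) :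
    ‖∑ i, (n i : ℂ) • b i‖ ^ 2 ≤ 1 + ε * (∑ i, |n i|) ^ 2 := by
  have hterm : ∀ i j, n i * (n j * (inner ℂ (b j) (b i)).re) ≤
      (if j = i then n i * n j else 0) + ε * (|n i| * |n j|) := fun i j => by
    have := mul_le_mul_of_nonneg_left (h j i) (abs_nonneg (n i * n j))
    rw [← abs_mul] at this
    rw [← abs_mul]
    split_ifs at this ⊢ <;> linarith [(abs_le.1 this).2]
  calc ‖∑ i, (n i : ℂ) • b i‖ ^ 2 = ∑ i, ∑ j, n i * (n j * (inner ℂ (b j) (b i)).re) := by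
        rw [@norm_sq_eq_re_inner ℂ, RCLike.re_eq_complex_re]
        simp only [sum_inner, inner_sum, inner_smul_left, inner_smul_right, Complex.re_sum,
          Complex.conj_ofReal, Complex.re_ofReal_mul, Finset.mul_sum]
    _ ≤ ∑ i, ∑ j, ((if j = i then n i * n j else 0) + ε * (|n i| * |n j|)) :=
        Finset.sum_le_sum fun i _ => Finset.sum_le_sum fun j _ => hterm i j
    _ = 1 + ε * (∑ i, |n i|) ^ 2 := by
        rw [sq (∑ i, |n i|), Finset.sum_mul_sum]
        simp only [sq] at hn
        simp only [Finset.sum_add_distrib, Finset.sum_ite_eq', Finset.mem_univ, if_true, hn,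
          Finset.mul_sum]

lemma norm_sub_sum_smul_sq_le [DecidableEq ι] (ht : ‖t‖ = 1) (hn : ∑ i, n i ^ 2 = 1)
    (hκ : ∀ i, n i ≠ 0 → |(inner ℂ t (b i)).re - n i| ≤ κ)
    (hε : ∀ i j, |(inner ℂ (b i) (b j)).re - if i = j then 1 else 0| ≤ ε) :
    ‖t - ∑ i, (n i : ℂ) • b i‖ ^ 2 ≤ 2 * κ * ∑ i, |n i| + ε * (∑ i, |n i|) ^ 2 := by
  rw [norm_sub_sq (𝕜 := ℂ), RCLike.re_eq_complex_re, ht]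
  linarith [re_inner_sum_smul_ge hn hκ, norm_sum_smul_sq_le hn hε]

end GramMatrix

section Strategy

variable {H : Type*} [NormedAddCommGroup H] [InnerProductSpace ℂ H]
variable {A : AliceSetting → H →L[ℂ] H} {B : BobSetting → H →L[ℂ] H} {ψ : H} {δ : ℝ}

/-- Commuting families of observables of Alice and Bob on a shared unit vector `ψ`; the tensor
product structure plays no other role in the argument. -/
structure IsStrategy (A : AliceSetting → H →L[ℂ] H) (B : BobSetting → H →L[ℂ] H) (ψ : H) :
    Prop where
  reflA : ∀ σ, IsReflection (A σ)
  reflB : ∀ β, IsReflection (B β)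
  comm : ∀ σ β, Commute (A σ) (B β)
  norm_eq_one : ‖ψ‖ = 1

/-- A strategy in which Alice's observables steer Bob's: up to `η`, each of them acts on `ψ` as the
combination of Bob's three observables that holds in the ideal case. -/
structure IsSteering (A : AliceSetting → H →L[ℂ] H) (B : BobSetting → H →L[ℂ] H) (ψ : H)
    (η : ℝ) : Prop extends IsStrategy A B ψ where
  steering : ∀ σ, ‖A σ ψ - ∑ β, (bloch σ β : ℂ) • B β ψ‖ ≤ η

namespace IsStrategy

lemma norm_A (h : IsStrategy A B ψ) (σ : AliceSetting) : ‖A σ ψ‖ = 1 := by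
  rw [(h.reflA σ).norm_apply, h.norm_eq_one]

lemma norm_B (h : IsStrategy A B ψ) (β : BobSetting) : ‖B β ψ‖ = 1 := by
  rw [(h.reflB β).norm_apply, h.norm_eq_one]

lemma norm_sum_bloch_smul_le (h : IsStrategy A B ψ) (σ : AliceSetting) :
    ‖∑ β, (bloch σ β : ℂ) • B β ψ‖ ≤ 2 :=
  calc ‖∑ β, (bloch σ β : ℂ) • B β ψ‖ ≤ ∑ β, ‖(bloch σ β : ℂ) • B β ψ‖ := norm_sum_le _ _
    _ = ∑ β, |bloch σ β| := by
        simp only [norm_smul, Complex.norm_real, Real.norm_eq_abs, h.norm_B, mul_one]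
    _ ≤ 2 := sum_abs_bloch_le σ

lemma abs_re_inner_sub_bloch_le (h : IsStrategy A B ψ) {σ : AliceSetting} {β : BobSetting} {χ : ℝ}
    (hχ : ‖inner ℂ ψ (A σ (B β ψ)) - idealCorrelation σ β‖ ≤ χ) :
    |(inner ℂ (A σ ψ) (B β ψ)).re - bloch σ β| ≤ χ := by
  rw [idealCorrelation_eq, ← (h.reflA σ).inner_left] at hχ
  exact (Complex.abs_re_le_norm _).trans hχ

variable (hδ : ∀ q ∈ testedSettings,
    ‖inner ℂ ψ (A q.1 (B q.2 ψ)) - idealCorrelation q.1 q.2‖ ≤ δ ^ 4)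
include hδ

lemma norm_label_sub_le_sq (h : IsStrategy A B ψ) (β : BobSetting) :
    ‖A β.label ψ - B β ψ‖ ≤ 2 * δ ^ 2 := by
  have hre := h.abs_re_inner_sub_bloch_le
    (hδ (β.label, β) (mem_testedSettings_of_bloch_ne_zero (by simp [bloch_label])))
  rw [bloch_label, if_pos rfl] at hre
  refine (sq_le_sq₀ (norm_nonneg _) (by positivity)).1 ?_
  rw [norm_sub_sq (𝕜 := ℂ), h.norm_A, h.norm_B, RCLike.re_eq_complex_re]
  nlinarith [(abs_le.1 hre).1, sq_nonneg (δ ^ 2)]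

lemma abs_re_inner_sub_le_of_tested (h : IsStrategy A B ψ) {β γ : BobSetting}
    (hβγ : (β.label, γ) ∈ testedSettings) :
    |(inner ℂ (B β ψ) (B γ ψ)).re - if β = γ then 1 else 0| ≤ δ ^ 4 + 2 * δ ^ 2 := by
  have hcorr := h.abs_re_inner_sub_bloch_le (hδ _ hβγ)
  rw [bloch_label] at hcorr
  have hsteer : |(inner ℂ (A β.label ψ - B β ψ) (B γ ψ)).re| ≤ 2 * δ ^ 2 := by
    refine (Complex.abs_re_le_norm _).trans ((norm_inner_le_norm _ _).trans ?_)
    rw [h.norm_B, mul_one]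
    exact h.norm_label_sub_le_sq hδ β
  rw [inner_sub_left, Complex.sub_re] at hsteer
  rw [abs_le] at *
  constructor <;> linarith

lemma abs_re_inner_sub_le (h : IsStrategy A B ψ) (β γ : BobSetting) :
    |(inner ℂ (B β ψ) (B γ ψ)).re - if β = γ then 1 else 0| ≤ δ ^ 4 + 2 * δ ^ 2 := by
  rcases label_mem_testedSettings β γ with hβγ | hγβ
  · exact h.abs_re_inner_sub_le_of_tested hδ hβγ
  · rw [← inner_conj_symm, Complex.conj_re]
    simpa only [eq_comm] using h.abs_re_inner_sub_le_of_tested hδ hγβ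

theorem isSteering (h : IsStrategy A B ψ) (hδ0 : 0 ≤ δ) : IsSteering A B ψ (4 * δ) where
  toIsStrategy := h
  steering σ := by
    rcases le_total δ 1 with h1 | h1
    · refine (sq_le_sq₀ (norm_nonneg _) (by positivity)).1 ?_
      calc _ ≤ 2 * δ ^ 4 * ∑ β, |bloch σ β| + (δ ^ 4 + 2 * δ ^ 2) * (∑ β, |bloch σ β|) ^ 2 :=
            norm_sub_sum_smul_sq_le (h.norm_A σ) (sum_sq_bloch σ)
              (fun β hβ => h.abs_re_inner_sub_bloch_le
                (hδ _ (mem_testedSettings_of_bloch_ne_zero hβ)))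
              (h.abs_re_inner_sub_le hδ)
        _ ≤ 2 * δ ^ 4 * 2 + (δ ^ 4 + 2 * δ ^ 2) * 2 ^ 2 := by
            gcongr <;> exact sum_abs_bloch_le σ
        _ ≤ (4 * δ) ^ 2 := by
            have := pow_le_pow_of_le_one hδ0 h1 (show 2 ≤ 4 by norm_num)
            linarith
    · linarith [norm_sub_le (A σ ψ) (∑ β, (bloch σ β : ℂ) • B β ψ), h.norm_A σ,
        h.norm_sum_bloch_smul_le σ]

end IsStrategy

end Strategy

section Anticommutator

variable {H : Type*} [NormedAddCommGroup H] [InnerProductSpace ℂ H]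

/-- The anticommutator `{P, Q}` of two operators, which vanishes for two different Pauli
observables. -/
def anticomm (P Q : H →L[ℂ] H) : H →L[ℂ] H :=
  P * Q + Q * P

lemma anticomm_apply (P Q : H →L[ℂ] H) (v : H) : anticomm P Q v = P (Q v) + Q (P v) := rfl

lemma commute_anticomm {S P Q : H →L[ℂ] H} (hP : Commute S P) (hQ : Commute S Q) :
    Commute S (anticomm P Q) :=
  (hP.mul_right hQ).add_right (hQ.mul_right hP)

lemma norm_anticomm_le {P Q : H →L[ℂ] H} (hP : IsReflection P) (hQ : IsReflection Q) :
    ‖anticomm P Q‖ ≤ 2 :=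
  ContinuousLinearMap.opNorm_le_bound _ zero_le_two fun v => by
    have h := norm_add_le (P (Q v)) (Q (P v))
    simp only [hP.norm_apply, hQ.norm_apply] at h
    rw [anticomm_apply]
    linarith

lemma norm_anticomm_apply_le {T P Q : H →L[ℂ] H} (hT : IsReflection T) (hP : IsReflection P)
    (hQ : IsReflection Q) (hTP : Commute T P) (hTQ : Commute T Q) (v : H) :
    ‖anticomm P Q v‖ ≤ 5 * ‖T v - ((1 / √2 : ℝ) : ℂ) • (P v + Q v)‖ := by
  set r : ℝ := 1 / √2
  have hr0 : 0 ≤ r := by positivity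
  have hr : r ^ 2 = 1 / 2 := inv_sqrt_two_sq
  have hrc : (r : ℂ) * r = 1 / 2 := by rw [← sq, ← Complex.ofReal_pow, hr]; norm_num
  set e := T v - (r : ℂ) • (P v + Q v) with he
  have hid : anticomm P Q v = (-2 : ℂ) • T e - (2 * (r : ℂ)) • (P e + Q e) := by
    have hTP' : ∀ u, T (P u) = P (T u) := DFunLike.congr_fun hTP.eq
    have hTQ' : ∀ u, T (Q u) = Q (T u) := DFunLike.congr_fun hTQ.eq
    simp only [anticomm_apply, he, map_sub, map_smul, map_add, hT.apply_apply, hP.apply_apply,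
      hQ.apply_apply, hTP', hTQ']
    match_scalars <;> grind
  have hsum : ‖P e + Q e‖ ≤ 2 * ‖e‖ := by
    linarith [norm_add_le (P e) (Q e), hP.norm_apply e, hQ.norm_apply e]
  calc ‖anticomm P Q v‖ ≤ ‖(-2 : ℂ) • T e‖ + ‖(2 * (r : ℂ)) • (P e + Q e)‖ :=
        hid ▸ norm_sub_le _ _
    _ = 2 * ‖e‖ + 2 * r * ‖P e + Q e‖ := by
        simp only [norm_smul, norm_mul, norm_neg, Complex.norm_real, Real.norm_of_nonneg hr0,
          Complex.norm_ofNat, hT.norm_apply]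
    _ ≤ 2 * ‖e‖ + 2 * (3 / 4) * (2 * ‖e‖) := by
        gcongr
        nlinarith
    _ = 5 * ‖e‖ := by ring

end Anticommutator

section SwapKickRelations

variable {H : Type*} [NormedAddCommGroup H] [InnerProductSpace ℂ H]
variable {B : BobSetting → H →L[ℂ] H}

lemma swapPart_zero_apply (B : BobSetting → H →L[ℂ] H) (v : H) :
    swapPart B 0 v = (1 / 2 : ℂ) • (v + B .Z v) := by
  simp [swapPart, opProj_apply]

lemma swapPart_one_apply (B : BobSetting → H →L[ℂ] H) (v : H) :
    swapPart B 1 v = (1 / 2 : ℂ) • (B .X v - B .X (B .Z v)) := by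
  simp [swapPart, opProj_apply, sub_eq_add_neg]

lemma phaseOp_apply (B : BobSetting → H →L[ℂ] H) (v : H) :
    phaseOp B v = Complex.I • B .Z (B .X (B .Y v)) := rfl

lemma swapPart_apply_Z (hB : ∀ β, IsReflection (B β)) (k : Fin 2) (v : H) :
    swapPart B k (B .Z v) = (-1 : ℂ) ^ (k : ℕ) • swapPart B k v := by
  obtain rfl | rfl : k = 0 ∨ k = 1 := by omega
  · simp only [swapPart_zero_apply, (hB _).apply_apply, Fin.val_zero]
    module
  · simp only [swapPart_one_apply, (hB _).apply_apply, Fin.val_one]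
    module

lemma norm_swapPart_apply_X_sub (hB : ∀ β, IsReflection (B β)) (k : Fin 2) (v : H) :
    ‖swapPart B k (B .X v) - swapPart B (1 - k) v‖ = 1 / 2 * ‖anticomm (B .X) (B .Z) v‖ := by
  obtain rfl | rfl : k = 0 ∨ k = 1 := by omega
  · have hid : swapPart B 0 (B .X v) - swapPart B 1 v
        = (1 / 2 : ℂ) • anticomm (B .X) (B .Z) v := by
      rw [swapPart_zero_apply, swapPart_one_apply, anticomm_apply]
      module
    rw [sub_zero, hid, norm_smul]
    norm_num
  · have hid : swapPart B 1 (B .X v) - swapPart B 0 v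
        = (-1 / 2 : ℂ) • B .X (anticomm (B .X) (B .Z) v) := by
      simp only [swapPart_zero_apply, swapPart_one_apply, anticomm_apply, map_add,
        (hB _).apply_apply]
      module
    rw [sub_self, hid, norm_smul, (hB _).norm_apply]
    norm_num

lemma norm_kickPart_phaseOp_sub (B : BobSetting → H →L[ℂ] H) (l : Fin 2) (v : H) :
    ‖kickPart B l (phaseOp B v) - (-1 : ℂ) ^ (l : ℕ) • kickPart B l v‖ =
      1 / 2 * ‖(phaseOp B * phaseOp B - 1) v‖ := by
  have hid : kickPart B l (phaseOp B v) - (-1 : ℂ) ^ (l : ℕ) • kickPart B l v =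
      ((-1 : ℂ) ^ (l : ℕ) / 2) • (phaseOp B (phaseOp B v) - v) := by
    simp only [kickPart, opProj_apply]
    obtain rfl | rfl : l = 0 ∨ l = 1 := by omega
    · simp only [Fin.val_zero]
      module
    · simp only [Fin.val_one]
      module
  rw [hid, norm_smul]
  simp

end SwapKickRelations

namespace IsSteering

variable {H : Type*} [NormedAddCommGroup H] [InnerProductSpace ℂ H]
variable {A : AliceSetting → H →L[ℂ] H} {B : BobSetting → H →L[ℂ] H} {ψ : H} {η : ℝ}

lemma nonneg (h : IsSteering A B ψ η) : 0 ≤ η :=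
  (norm_nonneg _).trans (h.steering .X)

lemma norm_label_sub_le (h : IsSteering A B ψ η) (β : BobSetting) :
    ‖A β.label ψ - B β ψ‖ ≤ η := by
  simpa [bloch_label] using h.steering β.label

lemma norm_anticomm_le (h : IsSteering A B ψ η) {β γ : BobSetting} (hβγ : β ≠ γ) :
    ‖anticomm (B β) (B γ) ψ‖ ≤ 5 * η := by
  obtain ⟨σ, hσ⟩ := exists_sum_bloch_smul_eq (E := H) hβγ
  have hsteer := h.steering σ
  rw [hσ] at hsteer
  linarith [norm_anticomm_apply_le (h.reflA σ) (h.reflB β) (h.reflB γ) (h.comm σ β) (h.comm σ γ) ψ]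

section Transfer

variable {W : H →L[ℂ] H} {c : ℝ}

-- On `ψ`, Bob's observable can be traded for Alice's, which `W` lets through.
lemma norm_apply_B_le (h : IsSteering A B ψ η) (hW : ∀ σ, Commute (A σ) W) (hc : ‖W‖ ≤ c)
    (β : BobSetting) : ‖W (B β ψ)‖ ≤ ‖W ψ‖ + c * η := by
  have hA : ‖W (A β.label ψ)‖ = ‖W ψ‖ := by
    rw [← mul_apply_eq_comp, ← (hW _).eq, mul_apply_eq_comp, (h.reflA _).norm_apply]
  have hsub : ‖W (A β.label ψ - B β ψ)‖ ≤ c * η :=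
    W.le_of_opNorm_le_of_le hc (h.norm_label_sub_le β)
  rw [map_sub] at hsub
  linarith [norm_le_norm_add_norm_sub (W (A β.label ψ)) (W (B β ψ))]

lemma norm_apply_B_B_le (h : IsSteering A B ψ η) (hW : ∀ σ, Commute (A σ) W) (hc : ‖W‖ ≤ c)
    (β γ : BobSetting) : ‖W (B β (B γ ψ))‖ ≤ ‖W ψ‖ + 2 * c * η := by
  have hWβ : ‖W * B β‖ ≤ c :=
    (norm_mul_le_of_le hc (h.reflB β).norm_le_one).trans_eq (mul_one c)
  have hγ := h.norm_apply_B_le (fun σ => (hW σ).mul_right (h.comm σ β)) hWβ γ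
  simp only [mul_apply_eq_comp] at hγ
  linarith [h.norm_apply_B_le hW hc β]

lemma norm_apply_swapPart_le (h : IsSteering A B ψ η) (hW : ∀ σ, Commute (A σ) W) (hc : ‖W‖ ≤ c)
    (k : Fin 2) : ‖W (swapPart B k ψ)‖ ≤ ‖W ψ‖ + 2 * c * η := by
  have hcη : 0 ≤ c * η := mul_nonneg ((norm_nonneg _).trans hc) h.nonneg
  obtain rfl | rfl : k = 0 ∨ k = 1 := by omega
  · rw [swapPart_zero_apply, map_smul, norm_smul, map_add]
    norm_num
    linarith [norm_add_le (W ψ) (W (B .Z ψ)), h.norm_apply_B_le hW hc .Z]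
  · rw [swapPart_one_apply, map_smul, norm_smul, map_sub]
    norm_num
    linarith [norm_sub_le (W (B .X ψ)) (W (B .X (B .Z ψ))), h.norm_apply_B_le hW hc .X,
      h.norm_apply_B_B_le hW hc .X .Z]

end Transfer

lemma norm_anticomm_B_le (h : IsSteering A B ψ η) {β γ : BobSetting} (hβγ : β ≠ γ)
    (α : BobSetting) : ‖anticomm (B β) (B γ) (B α ψ)‖ ≤ 7 * η := by
  linarith [h.norm_anticomm_le hβγ,
    h.norm_apply_B_le (fun σ => commute_anticomm (h.comm σ β) (h.comm σ γ))
      (RemotePrep.norm_anticomm_le (h.reflB β) (h.reflB γ)) α]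

lemma norm_anticomm_B_B_le (h : IsSteering A B ψ η) {β γ : BobSetting} (hβγ : β ≠ γ)
    (α α' : BobSetting) : ‖anticomm (B β) (B γ) (B α (B α' ψ))‖ ≤ 9 * η := by
  linarith [h.norm_anticomm_le hβγ,
    h.norm_apply_B_B_le (fun σ => commute_anticomm (h.comm σ β) (h.comm σ γ))
      (RemotePrep.norm_anticomm_le (h.reflB β) (h.reflB γ)) α α']

lemma norm_phaseOp_sq_sub_le (h : IsSteering A B ψ η) :
    ‖(phaseOp B * phaseOp B - 1) ψ‖ ≤ 23 * η := by
  have hid : (phaseOp B * phaseOp B - 1) ψ =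
      B .Z (B .X (B .Z (anticomm (B .X) (B .Y) (B .Y ψ)))) -
        B .Z (B .X (anticomm (B .Y) (B .Z) (B .X (B .Y ψ)))) -
        B .Z (anticomm (B .X) (B .Z) (B .X ψ)) := by
    change phaseOp B (phaseOp B ψ) - ψ = _
    simp only [phaseOp_apply, anticomm_apply, map_add, map_smul, smul_smul, Complex.I_mul_I,
      (h.reflB _).apply_apply]
    module
  rw [hid]
  refine (norm_sub_le _ _).trans ((add_le_add_left (norm_sub_le _ _) _).trans ?_)
  simp only [(h.reflB _).norm_apply]
  linarith [h.norm_anticomm_B_le (β := .X) (γ := .Y) nofun .Y,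
    h.norm_anticomm_B_B_le (β := .Y) (γ := .Z) nofun .X .Y,
    h.norm_anticomm_B_le (β := .X) (γ := .Z) nofun .X]

lemma commute_phaseOp (h : IsSteering A B ψ η) (σ : AliceSetting) : Commute (A σ) (phaseOp B) :=
  (((h.comm σ .Z).mul_right (h.comm σ .X)).mul_right (h.comm σ .Y)).smul_right _

lemma norm_kickPart_phaseOp_swapPart_sub_le (h : IsSteering A B ψ η) (k l : Fin 2) :
    ‖kickPart B l (phaseOp B (swapPart B k ψ)) - (-1 : ℂ) ^ (l : ℕ) •
      kickPart B l (swapPart B k ψ)‖ ≤ 16 * η := by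
  have hcomm : ∀ σ, Commute (A σ) (phaseOp B * phaseOp B - 1) := fun σ =>
    ((h.commute_phaseOp σ).mul_right (h.commute_phaseOp σ)).sub_right (Commute.one_right _)
  have hnorm : ‖phaseOp B * phaseOp B - 1‖ ≤ 2 :=
    ContinuousLinearMap.opNorm_le_bound _ zero_le_two fun v => by
      have hv := norm_sub_le (phaseOp B (phaseOp B v)) v
      simp only [norm_phaseOp_apply h.reflB] at hv
      exact hv.trans_eq (two_mul _).symm
  rw [norm_kickPart_phaseOp_sub]
  linarith [h.norm_apply_swapPart_le hcomm hnorm k, h.norm_phaseOp_sq_sub_le, h.nonneg]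

lemma norm_swapPart_zero_apply_Y_sub_le (h : IsSteering A B ψ η) :
    ‖swapPart B 0 (B .Y ψ) - Complex.I • phaseOp B (swapPart B 1 ψ)‖ ≤ 10 * η := by
  have hid : swapPart B 0 (B .Y ψ) - Complex.I • phaseOp B (swapPart B 1 ψ) =
      (1 / 2 : ℂ) • (B .Z (B .X (anticomm (B .X) (B .Y) ψ)) -
        B .Z (B .X (anticomm (B .X) (B .Y) (B .Z ψ))) + B .Z (anticomm (B .Y) (B .Z) ψ)) := by
    simp only [swapPart_zero_apply, swapPart_one_apply, phaseOp_apply, anticomm_apply, map_add,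
      map_sub, map_smul, smul_smul, (h.reflB _).apply_apply]
    match_scalars <;> grind [Complex.I_mul_I]
  have htri := norm_add_le_of_le (norm_sub_le (B .Z (B .X (anticomm (B .X) (B .Y) ψ)))
    (B .Z (B .X (anticomm (B .X) (B .Y) (B .Z ψ))))) (le_refl ‖B .Z (anticomm (B .Y) (B .Z) ψ)‖)
  simp only [(h.reflB _).norm_apply] at htri
  rw [hid, norm_smul]
  norm_num
  linarith [h.norm_anticomm_le (β := .X) (γ := .Y) nofun,
    h.norm_anticomm_B_le (β := .X) (γ := .Y) nofun .Z,
    h.norm_anticomm_le (β := .Y) (γ := .Z) nofun, h.nonneg]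

lemma norm_swapPart_one_apply_Y_add_le (h : IsSteering A B ψ η) :
    ‖swapPart B 1 (B .Y ψ) + Complex.I • phaseOp B (swapPart B 0 ψ)‖ ≤ 10 * η := by
  have hid : swapPart B 1 (B .Y ψ) + Complex.I • phaseOp B (swapPart B 0 ψ) =
      (1 / 2 : ℂ) • (B .Z (anticomm (B .X) (B .Z) (B .Y ψ)) -
        B .Z (B .X (anticomm (B .Y) (B .Z) ψ)) - anticomm (B .X) (B .Z) (B .Y ψ)) := by
    simp only [swapPart_zero_apply, swapPart_one_apply, phaseOp_apply, anticomm_apply, map_add,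
      map_smul, smul_smul, (h.reflB _).apply_apply]
    match_scalars <;> grind [Complex.I_mul_I]
  have htri := norm_sub_le_of_le (norm_sub_le (B .Z (anticomm (B .X) (B .Z) (B .Y ψ)))
    (B .Z (B .X (anticomm (B .Y) (B .Z) ψ)))) (le_refl ‖anticomm (B .X) (B .Z) (B .Y ψ)‖)
  simp only [(h.reflB _).norm_apply] at htri
  rw [hid, norm_smul]
  norm_num
  linarith [h.norm_anticomm_B_le (β := .X) (γ := .Z) nofun .Y,
    h.norm_anticomm_le (β := .Y) (γ := .Z) nofun, h.nonneg]

end IsSteering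

namespace IsSteering

variable {H : Type*} [NormedAddCommGroup H] [InnerProductSpace ℂ H]
variable {A : AliceSetting → H →L[ℂ] H} {B : BobSetting → H →L[ℂ] H} {ψ : H} {η : ℝ}

lemma norm_swapPart_apply_Y_sub_le (h : IsSteering A B ψ η) (k : Fin 2) :
    ‖swapPart B k (B .Y ψ) - ((-1 : ℂ) ^ (k : ℕ) * Complex.I) • phaseOp B (swapPart B (1 - k) ψ)‖ ≤
      10 * η := by
  obtain rfl | rfl : k = 0 ∨ k = 1 := by omega
  · simpa using h.norm_swapPart_zero_apply_Y_sub_le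
  · simpa using h.norm_swapPart_one_apply_Y_add_le

lemma norm_kickPart_swapPart_Y_sub_le (h : IsSteering A B ψ η) (k l : Fin 2) :
    ‖kickPart B l (swapPart B k (B .Y ψ)) -
      ((-1 : ℂ) ^ (k : ℕ) * Complex.I * (-1) ^ (l : ℕ)) • kickPart B l (swapPart B (1 - k) ψ)‖ ≤
      26 * η := by
  set γ : ℂ := (-1) ^ (k : ℕ) * Complex.I
  have hγ : ‖γ‖ = 1 := by simp [γ]
  have hswap := (norm_kickPart_le h.reflB l _).trans (h.norm_swapPart_apply_Y_sub_le k)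
  have hkick : ‖γ • (kickPart B l (phaseOp B (swapPart B (1 - k) ψ)) -
      (-1 : ℂ) ^ (l : ℕ) • kickPart B l (swapPart B (1 - k) ψ))‖ ≤ 16 * η := by
    rw [norm_smul, hγ, one_mul]
    exact h.norm_kickPart_phaseOp_swapPart_sub_le (1 - k) l
  have htri := norm_add_le_of_le hswap hkick
  rw [map_sub, map_smul, smul_sub, smul_smul, sub_add_sub_cancel] at htri
  linarith

lemma norm_kickPart_swapPart_B_sub_le (h : IsSteering A B ψ η) (β : BobSetting) (k l : Fin 2) :
    ‖kickPart B l (swapPart B k (B β ψ)) -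
      ∑ j, flagConj l (idealB β.label) k j • kickPart B l (swapPart B j ψ)‖ ≤ 26 * η := by
  have hη := h.nonneg
  rw [flagConj_idealB]
  cases β
  · have hX := (norm_kickPart_le h.reflB l _).trans (norm_swapPart_apply_X_sub h.reflB k ψ).le
    have hXZ := h.norm_anticomm_le (β := .X) (γ := .Z) nofun
    rw [map_sub] at hX
    refine le_trans (le_of_eq ?_) (hX.trans (by linarith))
    congr 2
    fin_cases k <;> simp [Fin.sum_univ_two, bloch_label]
  · refine le_trans (le_of_eq ?_) (h.norm_kickPart_swapPart_Y_sub_le k l)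
    congr 2
    fin_cases k <;> simp [Fin.sum_univ_two, bloch_label, mul_comm]
  · refine le_trans (le_of_eq ?_) (show 0 ≤ 26 * η by linarith)
    rw [swapPart_apply_Z h.reflB]
    fin_cases k <;> simp [Fin.sum_univ_two, bloch_label]

lemma norm_kickPart_swapPart_A_sub_le (h : IsSteering A B ψ η) (σ : AliceSetting) (k l : Fin 2) :
    ‖kickPart B l (swapPart B k (A σ ψ)) -
      ∑ j, flagConj l (idealB σ) k j • kickPart B l (swapPart B j ψ)‖ ≤ 53 * η := by
  have hsteer := (norm_kickPart_le h.reflB l _).trans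
    ((norm_swapPart_le h.reflB k _).trans (h.steering σ))
  have hB : ‖∑ β, (bloch σ β : ℂ) • (kickPart B l (swapPart B k (B β ψ)) -
      ∑ j, flagConj l (idealB β.label) k j • kickPart B l (swapPart B j ψ))‖ ≤ 52 * η :=
    calc _ ≤ ∑ β, |bloch σ β| * (26 * η) := norm_sum_le_of_le _ fun β _ => by
          rw [norm_smul, Complex.norm_real, Real.norm_eq_abs]
          exact mul_le_mul_of_nonneg_left (h.norm_kickPart_swapPart_B_sub_le β k l) (abs_nonneg _)
      _ = (∑ β, |bloch σ β|) * (26 * η) := (Finset.sum_mul _ _ _).symm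
      _ ≤ 2 * (26 * η) := mul_le_mul_of_nonneg_right (sum_abs_bloch_le σ) (by linarith [h.nonneg])
      _ = 52 * η := by ring
  have htri := norm_add_le_of_le hsteer hB
  simp only [map_sub, map_sum, map_smul, smul_sub, Finset.sum_sub_distrib, sub_add_sub_cancel,
    Finset.smul_sum, smul_smul] at htri
  rw [Finset.sum_comm] at htri
  simp only [← Finset.sum_smul, ← flagConj_idealB_apply_eq_sum] at htri
  linarith

lemma norm_kickPart_swapPart_opProj_sub_le (h : IsSteering A B ψ η) (σ : AliceSetting)
    (a k l : Fin 2) :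
    ‖kickPart B l (swapPart B k (opProj a (A σ) ψ)) -
      ∑ j, flagProj l a σ k j • kickPart B l (swapPart B j ψ)‖ ≤ 27 * η := by
  have hid : kickPart B l (swapPart B k (opProj a (A σ) ψ)) -
      ∑ j, flagProj l a σ k j • kickPart B l (swapPart B j ψ) =
      ((-1 : ℂ) ^ (a : ℕ) / 2) • (kickPart B l (swapPart B k (A σ ψ)) -
        ∑ j, flagConj l (idealB σ) k j • kickPart B l (swapPart B j ψ)) := by
    simp only [flagProj_eq, matProj, opProj_apply, map_smul, map_add, Matrix.smul_apply,
      Matrix.add_apply, Matrix.one_apply, smul_eq_mul, Fin.sum_univ_two]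
    obtain rfl | rfl : k = 0 ∨ k = 1 := by omega
    · simp only [if_true, if_false, zero_ne_one]
      module
    · simp only [if_true, if_false, one_ne_zero]
      module
  rw [hid, norm_smul]
  simp only [norm_div, norm_pow, norm_neg, norm_one, one_pow, Complex.norm_ofNat]
  linarith [h.norm_kickPart_swapPart_A_sub_le σ k l, h.nonneg]

-- `flagProj l a σ` has rank one, so its rows are proportional to row `a`.
lemma norm_smul_kickPart_sub_smul_le (h : IsSteering A B ψ η) (σ : AliceSetting)
    (a k l : Fin 2) :
    ‖flagProj l a σ a a • kickPart B l (swapPart B k (opProj a (A σ) ψ)) -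
      flagProj l a σ k a • kickPart B l (swapPart B a (opProj a (A σ) ψ))‖ ≤ 54 * η := by
  set R := flagProj l a σ
  set w := fun j => kickPart B l (swapPart B j ψ)
  have hrow : R a a • ∑ j, R k j • w j = R k a • ∑ j, R a j • w j := by
    simp only [Finset.smul_sum, smul_smul, R,
      apply_self_mul_apply_of_det_eq_zero (det_flagProj l a σ) a k]
  have hterm : ∀ i j, ‖R i a • (kickPart B l (swapPart B j (opProj a (A σ) ψ)) -
      ∑ i, R j i • w i)‖ ≤ 27 * η := fun i j => by
    rw [norm_smul]
    exact (mul_le_of_le_one_left (norm_nonneg _) (norm_flagProj_le_one l a σ i)).trans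
      (h.norm_kickPart_swapPart_opProj_sub_le σ a j l)
  have htri := norm_sub_le_of_le (hterm a k) (hterm k a)
  rw [smul_sub, smul_sub, hrow, sub_sub_sub_cancel_right] at htri
  linarith

end IsSteering

section Normalization

lemma norm_le_two_mul_of_forall {H : Type*} [NormedAddCommGroup H]
    {u : WithRegister (Fin 2 × Fin 2) H} {c : ℝ}
    (hu : ∀ k l, ‖u (k, l)‖ ≤ c) : ‖u‖ ≤ 2 * c := by
  have hc : 0 ≤ c := (norm_nonneg _).trans (hu 0 0)
  refine (sq_le_sq₀ (norm_nonneg _) (by positivity)).1 ?_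
  calc ‖u‖ ^ 2 = ∑ q, ‖u q‖ ^ 2 := PiLp.norm_sq_eq_of_L2 _ u
    _ ≤ ∑ _q : Fin 2 × Fin 2, c ^ 2 := by
        gcongr with q
        exact hu q.1 q.2
    _ = (2 * c) ^ 2 := by
        simp
        ring

variable {H : Type*} [NormedAddCommGroup H] [InnerProductSpace ℂ H]

lemma exists_norm_eq_one_norm_sub_eq [Nontrivial H] (v : H) :
    ∃ w : H, ‖w‖ = 1 ∧ ‖v - w‖ = |‖v‖ - 1| := by
  rcases eq_or_ne v 0 with rfl | hv
  · obtain ⟨w, hw⟩ := exists_norm_eq H zero_le_one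
    exact ⟨w, hw, by simp [hw]⟩
  · refine ⟨((‖v‖⁻¹ : ℝ) : ℂ) • v, ?_, ?_⟩
    · rw [norm_smul, Complex.norm_real, norm_inv, norm_norm,
        inv_mul_cancel₀ (norm_ne_zero_iff.2 hv)]
    · have hsub : v - ((‖v‖⁻¹ : ℝ) : ℂ) • v = ((1 - ‖v‖⁻¹ : ℝ) : ℂ) • v := by
        rw [Complex.ofReal_sub, Complex.ofReal_one, sub_smul, one_smul]
      rw [hsub, norm_smul, Complex.norm_real, Real.norm_eq_abs, ← abs_norm v, ← abs_mul, abs_norm,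
        sub_mul, one_mul, inv_mul_cancel₀ (norm_ne_zero_iff.2 hv)]

lemma norm_sq_smul_opProj {T : H →L[ℂ] H} (hT : IsReflection T) (a : Fin 2) (v : H) :
    ‖(√2 : ℂ) • opProj a T v‖ ^ 2 = ‖v‖ ^ 2 + (-1) ^ (a : ℕ) * (inner ℂ v (T v)).re := by
  have hsign : ‖(-1 : ℂ) ^ (a : ℕ)‖ = 1 := by simp
  have hre : ((-1 : ℂ) ^ (a : ℕ) * inner ℂ v (T v)).re =
      (-1) ^ (a : ℕ) * (inner ℂ v (T v)).re := by
    rw [← Complex.re_ofReal_mul]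
    push_cast
    rfl
  rw [opProj_apply, norm_smul, norm_smul, mul_pow, mul_pow, norm_add_sq (𝕜 := ℂ), norm_smul, hsign,
    hT.norm_apply, inner_smul_right, RCLike.re_eq_complex_re, hre,
    Complex.norm_real, Real.norm_eq_abs, sq_abs, Real.sq_sqrt zero_le_two]
  norm_num
  ring

lemma norm_inner_apply_le {S P Q : H →L[ℂ] H} (hS : IsReflection S) (hP : IsReflection P)
    (hQ : IsReflection Q) (hSQ : Commute S Q) {ψ : H} (hψ : ‖ψ‖ = 1) :
    ‖inner ℂ ψ (Q ψ)‖ ≤ ‖anticomm P Q ψ‖ / 2 + ‖S ψ - P ψ‖ := by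
  have hSQ' : S (Q ψ) = Q (S ψ) := DFunLike.congr_fun hSQ.eq ψ
  have hid : 2 * inner ℂ ψ (Q ψ) = inner ℂ (P ψ) (anticomm P Q ψ)
      + inner ℂ (S ψ - P ψ) (Q (S ψ)) + inner ℂ (P ψ) (Q (S ψ - P ψ)) := by
    simp only [anticomm_apply, map_sub, inner_add_right, inner_sub_left, inner_sub_right,
      hP.inner_apply_apply]
    rw [← hSQ', hS.inner_apply_apply]
    ring
  have htri : ‖2 * inner ℂ ψ (Q ψ)‖ ≤ ‖P ψ‖ * ‖anticomm P Q ψ‖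
      + ‖S ψ - P ψ‖ * ‖Q (S ψ)‖ + ‖P ψ‖ * ‖Q (S ψ - P ψ)‖ :=
    hid ▸ norm_add_le_of_le (norm_add_le_of_le (norm_inner_le_norm _ _) (norm_inner_le_norm _ _))
      (norm_inner_le_norm _ _)
  simp only [norm_mul, Complex.norm_ofNat, hP.norm_apply, hQ.norm_apply, hS.norm_apply, hψ] at htri
  linarith

end Normalization

namespace IsSteering

variable {H : Type*} [NormedAddCommGroup H] [InnerProductSpace ℂ H]
variable {A : AliceSetting → H →L[ℂ] H} {B : BobSetting → H →L[ℂ] H} {ψ : H} {η : ℝ}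

lemma norm_inner_B_le (h : IsSteering A B ψ η) (β : BobSetting) :
    ‖inner ℂ ψ (B β ψ)‖ ≤ 7 / 2 * η := by
  obtain ⟨γ, hγ⟩ : ∃ γ, γ ≠ β := exists_ne β
  linarith [norm_inner_apply_le (h.reflA γ.label) (h.reflB γ) (h.reflB β) (h.comm _ _)
    h.norm_eq_one, h.norm_anticomm_le hγ, h.norm_label_sub_le γ]

lemma norm_inner_A_le (h : IsSteering A B ψ η) (σ : AliceSetting) :
    ‖inner ℂ ψ (A σ ψ)‖ ≤ 8 * η := by
  have hsub : ‖inner ℂ ψ (A σ ψ - ∑ β, (bloch σ β : ℂ) • B β ψ)‖ ≤ η := by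
    refine (norm_inner_le_norm _ _).trans ?_
    rw [h.norm_eq_one, one_mul]
    exact h.steering σ
  have hsum : ‖inner ℂ ψ (∑ β, (bloch σ β : ℂ) • B β ψ)‖ ≤ 7 * η :=
    calc _ ≤ ∑ β, |bloch σ β| * (7 / 2 * η) := by
          rw [inner_sum]
          refine norm_sum_le_of_le _ fun β _ => ?_
          rw [inner_smul_right, norm_mul, Complex.norm_real, Real.norm_eq_abs]
          exact mul_le_mul_of_nonneg_left (h.norm_inner_B_le β) (abs_nonneg _)
      _ = (∑ β, |bloch σ β|) * (7 / 2 * η) := (Finset.sum_mul _ _ _).symm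
      _ ≤ 2 * (7 / 2 * η) :=
          mul_le_mul_of_nonneg_right (sum_abs_bloch_le σ) (by linarith [h.nonneg])
      _ = 7 * η := by ring
  have htri := norm_add_le_of_le hsub hsum
  rw [← inner_add_right, sub_add_cancel] at htri
  linarith

lemma norm_swapKick_sub_appendQubit_le (h : IsSteering A B ψ η) (σ : AliceSetting) (a : Fin 2) :
    ‖swapKick B h.reflB ((√2 : ℂ) • opProj a (A σ) ψ) -
      appendQubit B h.reflB (preparedQubit a σ) (sum_norm_sq_preparedQubit a σ)
        (((1 / √(refWeight a σ) : ℝ) : ℂ) • swapPart B a (opProj a (A σ) ψ))‖ ≤ 324 * η := by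
  set p := refWeight a σ
  have hp : 1 / 4 ≤ p := refWeight_ge a σ
  have hp0 : 0 < p := by linarith
  have hcoeff : √2 / (2 * p) ≤ 3 := by
    rw [div_le_iff₀ (by positivity), Real.sqrt_le_left (by positivity)]
    nlinarith
  refine (norm_le_two_mul_of_forall (c := 3 * (54 * η)) fun k l => ?_).trans_eq (by ring)
  set w := fun k => kickPart B l (swapPart B k (opProj a (A σ) ψ))
  have hdiag : √2 / (2 * p) * (2 * p) = √2 := div_mul_cancel₀ _ (by positivity)
  have hoff : 1 / √p * (1 / √2) * (1 / √p) = √2 / (2 * p) := by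
    rw [mul_right_comm, ← sq, div_pow, one_pow, Real.sq_sqrt hp0.le,
      ← Real.sqrt_div_self' (x := 2)]
    ring
  calc _ = ‖(√2 : ℂ) • w k - preparedQubit a σ l k • ((1 / √p : ℝ) : ℂ) • w a‖ := by
        rw [PiLp.sub_apply, swapKick_apply, appendQubit_apply]
        simp only [map_smul, w]
    _ = ‖((√2 / (2 * p) : ℝ) : ℂ) •
          (flagProj l a σ a a • w k - flagProj l a σ k a • w a)‖ := by
        rw [preparedQubit_eq, flagProj_apply_self, smul_sub, smul_smul, smul_smul, smul_smul,
          ← Complex.ofReal_mul, hdiag, ← hoff]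
        push_cast
        congr 3
        ring
    _ = √2 / (2 * p) * ‖flagProj l a σ a a • w k - flagProj l a σ k a • w a‖ := by
        rw [norm_smul, Complex.norm_real, Real.norm_of_nonneg (by positivity)]
    _ ≤ 3 * (54 * η) :=
        mul_le_mul hcoeff (h.norm_smul_kickPart_sub_smul_le σ a k l) (norm_nonneg _) (by norm_num)

theorem exists_junk (h : IsSteering A B ψ η) (σ : AliceSetting) (a : Fin 2) :
    ∃ junk : H, ‖junk‖ = 1 ∧
      ‖swapKick B h.reflB ((√2 : ℂ) • opProj a (A σ) ψ) -
        appendQubit B h.reflB (preparedQubit a σ) (sum_norm_sq_preparedQubit a σ) junk‖ ≤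
        656 * η := by
  set V := swapKick B h.reflB
  set W := appendQubit B h.reflB (preparedQubit a σ) (sum_norm_sq_preparedQubit a σ)
  set v := (√2 : ℂ) • opProj a (A σ) ψ with hv
  set J := ((1 / √(refWeight a σ) : ℝ) : ℂ) • swapPart B a (opProj a (A σ) ψ)
  have hVW : ‖V v - W J‖ ≤ 324 * η := h.norm_swapKick_sub_appendQubit_le σ a
  have : Nontrivial H := ⟨ψ, 0, norm_ne_zero_iff.1 (h.norm_eq_one.trans_ne one_ne_zero)⟩
  have hJ : |‖J‖ - ‖v‖| ≤ 324 * η := by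
    rw [← V.norm_map v, ← W.norm_map J, abs_sub_comm]
    exact (abs_norm_sub_norm_le _ _).trans hVW
  have hnorm : |‖v‖ - 1| ≤ 8 * η := by
    calc |‖v‖ - 1| ≤ |‖v‖ - 1| * |‖v‖ + 1| := le_mul_of_one_le_right (abs_nonneg _) (by
          rw [abs_of_nonneg (by positivity)]
          linarith [norm_nonneg v])
      _ = |(inner ℂ ψ (A σ ψ)).re| := by
          rw [← abs_mul, show (‖v‖ - 1) * (‖v‖ + 1) = ‖v‖ ^ 2 - 1 by ring, hv,
            norm_sq_smul_opProj (h.reflA σ), h.norm_eq_one]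
          simp [abs_mul]
      _ ≤ 8 * η := (Complex.abs_re_le_norm _).trans (h.norm_inner_A_le σ)
  obtain ⟨junk, hjunk, hJjunk⟩ := exists_norm_eq_one_norm_sub_eq J
  refine ⟨junk, hjunk, ?_⟩
  calc ‖V v - W junk‖ ≤ ‖V v - W J‖ + ‖W J - W junk‖ := norm_sub_le_norm_sub_add_norm_sub _ _ _
    _ = ‖V v - W J‖ + |‖J‖ - 1| := by rw [← map_sub, W.norm_map, hJjunk]
    _ ≤ 324 * η + (324 * η + 8 * η) :=
        add_le_add hVW ((abs_sub_le _ _ _).trans (add_le_add hJ hnorm))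
    _ = 656 * η := by ring

end IsSteering

section Registers

lemma norm_eq_of_supported {H : Type*} [NormedAddCommGroup H] {a : Fin 2}
    {v : WithRegister (Fin 2 × Fin 2 × Fin 2) H} {u : WithRegister (Fin 2 × Fin 2) H}
    (h : ∀ i q, v (i, q) = if i = a then u q else 0) : ‖v‖ = ‖u‖ := by
  rw [← sq_eq_sq₀ (norm_nonneg _) (norm_nonneg _), PiLp.norm_sq_eq_of_L2, PiLp.norm_sq_eq_of_L2,
    Fintype.sum_prod_type_right]
  simp only [h, apply_ite norm, ite_pow, norm_zero, zero_pow two_ne_zero, Finset.sum_ite_eq',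
    Finset.mem_univ, if_true]

variable {HA : Type u} [NormedAddCommGroup HA] [InnerProductSpace ℂ HA]
variable {HB : Type v} [NormedAddCommGroup HB] [InnerProductSpace ℂ HB]
variable {A : AliceSetting → HA →L[ℂ] HA} {B : BobSetting → HB →L[ℂ] HB}

lemma localIsometry_swapKick_apply (hB : ∀ β, IsReflection (B β)) (a : Fin 2) (Ψ : Shared HA HB)
    (i : Fin 2) (q : Fin 2 × Fin 2) :
    localIsometry a (swapKick B hB) Ψ (i, q) =
      if i = a then swapKick (fun β => rightAction (B β)) (fun β => (hB β).rightAction) Ψ q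
      else 0 := by
  have hV : PiLp.proj 2 (fun _ : Fin 2 × Fin 2 => HB) q ∘L
      (swapKick B hB).toContinuousLinearMap = kickPart B q.2 * swapPart B q.1 := rfl
  change (if i = a then rightAction _ Ψ else 0) = _
  rw [hV, map_mul, map_kickPart, map_swapPart]
  rfl

lemma targetState_apply (hB : ∀ β, IsReflection (B β)) (a : Fin 2) (σ : AliceSetting)
    (junk : Shared HA HB) (i : Fin 2) (q : Fin 2 × Fin 2) :
    targetState B a σ junk (i, q) =
      if i = a then appendQubit (fun β => rightAction (B β)) (fun β => (hB β).rightAction)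
        (preparedQubit a σ) (sum_norm_sq_preparedQubit a σ) junk q
      else 0 := by
  change (((1 / √(refWeight a σ) : ℝ) : ℂ) * refQubits a σ q.2 (i, q.1)) •
    rightAction (kickPart B q.2) junk = _
  rcases eq_or_ne i a with rfl | hi
  · rw [if_pos rfl, map_kickPart]
    rfl
  · rw [if_neg hi, refQubits_eq, if_neg hi, mul_zero, zero_smul]

lemma norm_localIsometry_sub_targetState (hB : ∀ β, IsReflection (B β)) (a : Fin 2)
    (σ : AliceSetting) (Ψ junk : Shared HA HB) :
    ‖localIsometry a (swapKick B hB) Ψ - targetState B a σ junk‖ =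
      ‖swapKick (fun β => rightAction (B β)) (fun β => (hB β).rightAction) Ψ -
        appendQubit (fun β => rightAction (B β)) (fun β => (hB β).rightAction)
          (preparedQubit a σ) (sum_norm_sq_preparedQubit a σ) junk‖ :=
  norm_eq_of_supported (a := a) fun i q => by
    rw [PiLp.sub_apply, localIsometry_swapKick_apply, targetState_apply hB a, PiLp.sub_apply]
    split_ifs
    · rfl
    · rw [sub_zero]

lemma isStrategy_leftAction_rightAction (hA : ∀ α, IsReflection (A α))
    (hB : ∀ β, IsReflection (B β)) {ψ : Shared HA HB} (hψ : ‖ψ‖ = 1) :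
    IsStrategy (fun σ => leftAction (A σ)) (fun β => rightAction (B β)) ψ where
  reflA σ := (hA σ).leftAction
  reflB β := (hB β).rightAction
  comm _ _ := commute_leftAction_rightAction _ _
  norm_eq_one := hψ

lemma CorrelationsClose.nonneg {ψ : Shared HA HB} {χ : ℝ} (h : CorrelationsClose A B ψ χ) :
    0 ≤ χ :=
  (norm_nonneg _).trans (h (.X, .X) (Set.mem_insert _ _))

lemma CorrelationsClose.isSteering (hA : ∀ α, IsReflection (A α))
    (hB : ∀ β, IsReflection (B β)) {ψ : Shared HA HB} (hψ : ‖ψ‖ = 1) {χ : ℝ}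
    (h : CorrelationsClose A B ψ χ) :
    IsSteering (fun σ => leftAction (A σ)) (fun β => rightAction (B β)) ψ
      (4 * χ ^ (1 / 4 : ℝ)) := by
  refine (isStrategy_leftAction_rightAction hA hB hψ).isSteering (fun q hq => ?_)
    (Real.rpow_nonneg h.nonneg _)
  have hq' := h q hq
  rw [← leftAction_mul_rightAction] at hq'
  rw [← Real.rpow_mul_natCast h.nonneg]
  rwa [show (1 / 4 : ℝ) * (4 : ℕ) = 1 by norm_num, Real.rpow_one]

end Registers

end RemotePrep

end

open RemotePrep

theorem theorem1_general :
    ∃ C : ℝ,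
      ∀ (HA : Type u) [NormedAddCommGroup HA] [InnerProductSpace ℂ HA]
        (HB : Type v) [NormedAddCommGroup HB] [InnerProductSpace ℂ HB]
        (A : AliceSetting → HA →L[ℂ] HA) (B : BobSetting → HB →L[ℂ] HB)
        (ψ : Shared HA HB) (χ : ℝ),
        (∀ α, IsReflection (A α)) → (∀ β, IsReflection (B β)) → ‖ψ‖ = 1 →
        CorrelationsClose A B ψ χ →
        ∃ V : HB →ₗᵢ[ℂ] WithRegister (Fin 2 × Fin 2) HB,
          (∀ (b : HB) (k l : Fin 2), V b (k, l) = kickPart B l (swapPart B k b)) ∧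
          ∀ (σ : AliceSetting) (a : Fin 2), ∃ junk : Shared HA HB, ‖junk‖ = 1 ∧
            ‖localIsometry a V
                ((√2 : ℂ) • tensorOp (opProj a (A σ)) (1 : HB →L[ℂ] HB) ψ) -
              targetState B a σ junk‖ ≤ C * χ ^ (1 / 4 : ℝ) := by
  refine ⟨656 * 4, fun HA _ _ HB _ _ A B ψ χ hA hB hψ h => ⟨swapKick B hB, swapKick_apply hB,
    fun σ a => ?_⟩⟩
  obtain ⟨junk, hjunk, hbound⟩ := (h.isSteering hA hB hψ).exists_junk σ a
  refine ⟨junk, hjunk, ?_⟩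
  rw [norm_localIsometry_sub_targetState, ← leftAction_apply, map_opProj, mul_assoc]
  exact hbound

theorem theorem1 :
    ∃ C : ℝ,
      ∀ (HA : Type u) [NormedAddCommGroup HA] [InnerProductSpace ℂ HA] [CompleteSpace HA]
        (HB : Type v) [NormedAddCommGroup HB] [InnerProductSpace ℂ HB] [CompleteSpace HB]
        (A : AliceSetting → HA →L[ℂ] HA) (B : BobSetting → HB →L[ℂ] HB)
        (ψ : Shared HA HB) (χ : ℝ),
        (∀ α, IsBinaryObservable (A α)) → (∀ β, IsBinaryObservable (B β)) → ‖ψ‖ = 1 →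
        CorrelationsClose A B ψ χ →
        ∃ V : HB →ₗᵢ[ℂ] WithRegister (Fin 2 × Fin 2) HB,
          (∀ (b : HB) (k l : Fin 2), V b (k, l) = kickPart B l (swapPart B k b)) ∧
          ∀ (σ : AliceSetting) (a : Fin 2), ∃ junk : Shared HA HB, ‖junk‖ = 1 ∧
            ‖localIsometry a V
                ((√2 : ℂ) • tensorOp (opProj a (A σ)) (1 : HB →L[ℂ] HB) ψ) -
              targetState B a σ junk‖ ≤ C * χ ^ (1 / 4 : ℝ) := by
  obtain ⟨C, hC⟩ := theorem1_general.{u, v}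
  exact ⟨C, fun HA _ _ _ HB _ _ _ A B ψ χ hA hB =>
    hC HA HB A B ψ χ (fun α => (hA α).isReflection) fun β => (hB β).isReflection⟩
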